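/- Let $p$ be a prime, let $k$ be a field of characteristic $p$, let $r \ge 1$, and let $G$ be a group of order $p^r$. Let $\mathrm{StMod}(kG)$ be the stable module category, whose objects are the $kG$-modules and whose morphisms are the $kG$-homomorphisms modulo those that factor through a projective module, with its usual triangulated structure, and let $\mathrm{thick}\langle k\rangle$ be the thick subcategory generated by the trivial module $k$ (the smallest full triangulated subcategory of $\mathrm{StMod}(kG)$ that contains $k$ and is closed under retracts). A map in $\mathrm{StMod}(kG)$ is called a ghost if it induces the zero map on Tate cohomology $\hat H^n(G,-)$ for all $n \in \mathbb{Z}$. The ghost length of $M \in \mathrm{thick}\langle k\rangle$ is the smallest $n \ge 0$ such that every composite of $n$ ghosts in $\mathrm{thick}\langle k\rangle$ with domain $M$ is zero in $\mathrm{StMod}(kG)$ (for $n = 0$: such that every map in $\mathrm{thick}\langle k\rangle$ with domain $M$ is zero; the ghost length is $\infty$ if there is no such $n$). The ghost number of $kG$ is the least upper bound of the ghost lengths of the modules in $\mathrm{thick}\langle k\rangle$. Then the ghost number of $kG$ is at least $(r-1)(p-1)+1$. -/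

import Mathlib

open CategoryTheory

universe u

namespace GhostNumber

noncomputable section

section StableCategory

variable (k G : Type u) [Field k] [Group G]

/-- A map of `kG`-modules (that is, of representations of `G` over `k`) is stably trivial if it
factors through a projective module. -/
def StablyTrivial {k G : Type u} [Field k] [Group G] {M N : Rep.{u} k G} (f : M ⟶ N) : Prop :=
  ∃ (P : Rep.{u} k G) (_ : Projective P) (a : M ⟶ P) (b : P ⟶ N), a ≫ b = f

/-- Two maps of `kG`-modules are stably equal if their difference is stably trivial. -/
def stableRel : HomRel (Rep.{u} k G) := fun _ _ f g => StablyTrivial (f - g)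

variable {k G}

theorem StablyTrivial.zero {M N : Rep.{u} k G} : StablyTrivial (0 : M ⟶ N) :=
  open scoped ZeroObject in ⟨(0 : Rep.{u} k G), inferInstance, 0, 0, by simp⟩

theorem StablyTrivial.add {M N : Rep.{u} k G} {f g : M ⟶ N}
    (hf : StablyTrivial f) (hg : StablyTrivial g) : StablyTrivial (f + g) := by
  obtain ⟨P, hP, a, b, rfl⟩ := hf
  obtain ⟨Q, hQ, c, d, rfl⟩ := hg
  exact ⟨P ⊞ Q, inferInstance, Limits.biprod.lift a c, Limits.biprod.desc b d, by simp⟩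

theorem StablyTrivial.neg {M N : Rep.{u} k G} {f : M ⟶ N}
    (hf : StablyTrivial f) : StablyTrivial (-f) := by
  obtain ⟨P, hP, a, b, rfl⟩ := hf
  exact ⟨P, hP, -a, b, by simp⟩

instance stableRel_congruence : Congruence (stableRel k G) where
  equivalence :=
    { refl := fun f => by
        simpa [stableRel] using StablyTrivial.zero
      symm := fun {f g} h => by
        simpa [stableRel] using StablyTrivial.neg h
      trans := fun {f g h} h₁ h₂ => by
        simpa [stableRel] using StablyTrivial.add h₁ h₂ }
  comp_left := by
    rintro X Y Z f g g' ⟨P, hP, a, b, h⟩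
    exact ⟨P, hP, f ≫ a, b, by rw [Category.assoc, h, Preadditive.comp_sub]⟩
  comp_right := by
    rintro X Y Z f f' g ⟨P, hP, a, b, h⟩
    exact ⟨P, hP, a, b ≫ g, by rw [← Category.assoc, h, Preadditive.sub_comp]⟩

variable (k G)

/-- The stable module category `StMod(kG)`: its objects are all `kG`-modules, and its hom-sets are
`Hom(M, N) / PHom(M, N)`, where `PHom(M, N)` is the group of stably trivial maps. -/
abbrev StMod := Quotient (stableRel k G)

/-- The quotient functor from `kG`-modules to the stable module category. -/
abbrev toStMod : Rep.{u} k G ⥤ StMod k G := Quotient.functor (stableRel k G)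

instance stMod_preadditive : Preadditive (StMod k G) :=
  Quotient.preadditive (stableRel k G) (by
    intro X Y f₁ f₂ g₁ g₂ h₁ h₂
    have h := StablyTrivial.add h₁ h₂
    rwa [sub_add_sub_comm] at h)

/-- The trivial representation `k`, as an object of the stable module category. -/
def trivialObj : StMod k G := (toStMod k G).obj (Rep.trivial k G k)

/-- The thick subcategory of `StMod(kG)` generated by `k`: the smallest class of objects that
contains `k` and is closed under retracts (in `StMod(kG)`) and under the two-out-of-three property
for exact triangles. The exact triangles of `StMod(kG)` are, up to isomorphism, those that come from
short exact sequences of `kG`-modules. Zero objects, hence projective modules, are retracts of `k`,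
so closure under `Σ` and `Ω` is the case of a sequence whose middle term is projective. -/
inductive ThickTriv : StMod k G → Prop
  | triv : ThickTriv (trivialObj k G)
  | retract {X Y : StMod k G} : Retract X Y → ThickTriv Y → ThickTriv X
  | ext₁ (S : ShortComplex (Rep.{u} k G)) : S.ShortExact →
      ThickTriv ((toStMod k G).obj S.X₂) → ThickTriv ((toStMod k G).obj S.X₃) →
      ThickTriv ((toStMod k G).obj S.X₁)
  | ext₂ (S : ShortComplex (Rep.{u} k G)) : S.ShortExact →
      ThickTriv ((toStMod k G).obj S.X₁) → ThickTriv ((toStMod k G).obj S.X₃) →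
      ThickTriv ((toStMod k G).obj S.X₂)
  | ext₃ (S : ShortComplex (Rep.{u} k G)) : S.ShortExact →
      ThickTriv ((toStMod k G).obj S.X₁) → ThickTriv ((toStMod k G).obj S.X₂) →
      ThickTriv ((toStMod k G).obj S.X₃)

end StableCategory

section Ghosts

variable (k G : Type u) [Field k] [Group G] [Fintype G]

variable {k G} in
/-- A stable map is a ghost if it induces the zero map in Tate cohomology in every degree `n : ℤ`.
As Tate cohomology vanishes on projective modules, the induced map does not depend on the
homomorphism `φ` of `kG`-modules that represents the stable map `f`. -/
def IsGhost {M N : StMod k G} (f : M ⟶ N) : Prop :=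
  ∃ φ : M.as ⟶ N.as, (toStMod k G).map φ = f ∧
    ∀ n : ℤ, (tateCohomologyFunctor n).map φ = 0

variable {k G} in
/-- `IsGhostComposite n f` says that `f` is in the `n`-th power of the ideal of ghosts in the thick
subcategory generated by `k`: it is a composite of `n` ghosts between objects of that subcategory
(any map of the subcategory if `n = 0`; note that a ghost precomposed with any map is a ghost). -/
inductive IsGhostComposite : ℕ → ∀ {M N : StMod k G}, (M ⟶ N) → Prop
  | zero {M N : StMod k G} (f : M ⟶ N) : ThickTriv k G M → ThickTriv k G N → IsGhostComposite 0 f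
  | succ {n : ℕ} {M N L : StMod k G} (f : M ⟶ N) (g : N ⟶ L) :
      IsGhostComposite n f → ThickTriv k G L → IsGhost g → IsGhostComposite (n + 1) (f ≫ g)

variable {k G} in
/-- The ghost length of `M`: the smallest `n` such that every `n`-fold composite of ghosts in the
thick subcategory generated by `k` with domain `M` is stably trivial (`⊤` if there is none). -/
def ghostLength (M : StMod k G) : ℕ∞ :=
  ⨅ (n : ℕ) (_ : ∀ (N : StMod k G) (f : M ⟶ N), IsGhostComposite n f → f = 0), (n : ℕ∞)

/-- The ghost number of `kG`: the least upper bound of the ghost lengths of the modules in the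
thick subcategory generated by `k`. -/
def ghostNumber : ℕ∞ := ⨆ (M : StMod k G) (_ : ThickTriv k G M), ghostLength M

end Ghosts

end

end GhostNumber

/-! Choose a central subgroup `C` of order `p` and let `M` be the `kG`-module of functions `G ⧸ C →
k`. Right translation by `q` in `G ⧸ C` is an endomorphism of `M`. Under Shapiro's isomorphism of
the Tate cohomology of `M` with that of `C` with coefficients in `k`, it becomes conjugation on `C`,
which is trivial because `C` is central. So each `q - 1` is a ghost (`tateCohomology_cosetDiff`).

In characteristic `p`, the norm element of the group `G ⧸ C` of order `p ^ (r - 1)` is a product of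
`(r - 1) * (p - 1)` factors `q - 1` (`exists_list_prod_sub_one_eq_sum`). Hence the norm on `M` is a
composite of that many ghosts. It is a nonzero map, and it stays nonzero stably: a stably trivial
endomorphism of `M` is a sum of `C`-conjugates, and as `C` acts trivially on `M` such a sum is a
multiple of `p` (`eq_zero_of_stablyTrivial`). Finally `M` is finite-dimensional over a `p`-group, so
it is built from copies of `k` by extensions (`thickTriv_of_finite`).

The ghost property is shown by a direct computation in degree 0 followed by dimension shifting. The
shift replaces `k` by its syzygies, so the statement is proved for all coefficients `L` satisfying
`ActsStablyTrivially`, a condition preserved by the shift in both directions. -/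

namespace GhostNumber

/-! ### Sums of conjugates of linear maps -/

section ConjSum

variable {k H V W X : Type*} [CommRing k] [Group H] [Fintype H]
  [AddCommGroup V] [Module k V] [AddCommGroup W] [Module k W] [AddCommGroup X] [Module k X]

/-- The sum of the `H`-conjugates of a linear map between two representations of `H`. -/
def conjSum (ρ : Representation k H V) (σ : Representation k H W) (e : V →ₗ[k] W) : V →ₗ[k] W :=
  ∑ h : H, σ h ∘ₗ e ∘ₗ ρ h⁻¹

variable {ρ : Representation k H V} {σ : Representation k H W} {τ : Representation k H X}

theorem conjSum_apply (e : V →ₗ[k] W) (v : V) :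
    conjSum ρ σ e v = ∑ h : H, σ h (e (ρ h⁻¹ v)) := by
  simp [conjSum]

theorem conjSum_zero : conjSum ρ σ 0 = 0 := by simp [conjSum]

theorem comp_conjSum (θ : W →ₗ[k] X) (hθ : ∀ h w, θ (σ h w) = τ h (θ w)) (e : V →ₗ[k] W) :
    θ ∘ₗ conjSum ρ σ e = conjSum ρ τ (θ ∘ₗ e) := by
  ext v
  simp [conjSum_apply, map_sum, hθ]

theorem conjSum_comp (θ : V →ₗ[k] W) (hθ : ∀ h v, θ (ρ h v) = σ h (θ v)) (e : W →ₗ[k] X) :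
    conjSum σ τ e ∘ₗ θ = conjSum ρ τ (e ∘ₗ θ) := by
  ext v
  simp [conjSum_apply, hθ]

theorem conjSum_equivariant (e : V →ₗ[k] W) (h : H) (v : V) :
    conjSum ρ σ e (ρ h v) = σ h (conjSum ρ σ e v) := by
  simp only [conjSum_apply, map_sum]
  refine Fintype.sum_equiv (Equiv.mulLeft h⁻¹) _ _ fun x => ?_
  simp [← Module.End.mul_apply, ← map_mul]

/-- A sum of conjugates over a group is a sum of conjugates over any of its subgroups. -/
theorem exists_conjSum_subgroup (C : Subgroup H) [Fintype C] (e : V →ₗ[k] W) :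
    ∃ d : V →ₗ[k] W,
      conjSum (ρ.comp C.subtype) (σ.comp C.subtype) d = conjSum ρ σ e := by
  classical
  obtain ⟨T, hT, -⟩ := C.exists_isComplement_right (1 : H)
  have : Fintype T := Fintype.ofFinite _
  -- Every `h` is uniquely `c * t` with `t` in the transversal `T`; the sum over `t` is absorbed in
  -- the linear map.
  refine ⟨∑ t : T, σ t ∘ₗ e ∘ₗ ρ (t : H)⁻¹, ?_⟩
  ext v
  have hbij : Function.Bijective fun x : C × T => (x.1 : H) * x.2 := hT
  simp only [conjSum_apply, LinearMap.sum_apply, map_sum, LinearMap.comp_apply]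
  rw [← Fintype.sum_prod_type']
  refine Fintype.sum_bijective _ hbij _ _ fun x => ?_
  simp

end ConjSum

/-! ### Short exact sequences in terms of elements -/

section RepShortExact

variable {k G : Type u} [Field k] [Group G]

theorem shortExact_iff (S : ShortComplex (Rep.{u} k G)) :
    S.ShortExact ↔ Function.Injective S.f.hom ∧ Function.Surjective S.g.hom ∧
      ∀ x : S.X₂, S.g.hom x = 0 → ∃ y : S.X₁, S.f.hom y = x := by
  have hex : S.Exact ↔ ∀ x : S.X₂, S.g.hom x = 0 → ∃ y : S.X₁, S.f.hom y = x := by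
    rw [← ShortComplex.exact_map_iff_of_faithful S (forget₂ (Rep.{u} k G) (ModuleCat.{u} k)),
      ShortComplex.moduleCat_exact_iff]
    rfl
  rw [← hex, ← Rep.mono_iff_injective, ← Rep.epi_iff_surjective]
  exact ⟨fun h => ⟨h.mono_f, h.epi_g, h.exact⟩, fun ⟨_, _, h⟩ => { exact := h }⟩

end RepShortExact

/-! ### Induced representations -/

section Induced

variable {k G : Type u} [Field k] [Group G] [Fintype G]

/-- A representation is induced (from the trivial subgroup, up to retracts) if its identity is a sum
of conjugates. -/
def IsInduced (A : Rep.{u} k G) : Prop :=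
  ∃ e : A →ₗ[k] A, conjSum A.ρ A.ρ e = LinearMap.id

/-- The representation of `G` on the functions `G → L` by right translation. -/
noncomputable def inducedRep (L : Rep.{u} k G) : Rep.{u} k G :=
  Rep.of (X := G → L) (ρ :=
    { toFun g := LinearMap.funLeft k L (· * g)
      map_one' := by ext; simp [LinearMap.funLeft]
      map_mul' _ _ := by ext; simp [LinearMap.funLeft, mul_assoc] })

/-- The conjugates of the projection to the coordinate at `1` are the projections to all the
coordinates, and these add up to the identity. -/
theorem isInduced_inducedRep (L : Rep.{u} k G) : IsInduced (inducedRep L) := by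
  classical
  refine ⟨(LinearMap.single k (fun _ : G => L.V) 1) ∘ₗ (LinearMap.proj 1), ?_⟩
  refine LinearMap.ext fun f => (conjSum_apply _ f).trans (funext fun x => ?_)
  change G → L at f
  refine (Finset.sum_apply x Finset.univ _).trans ?_
  rw [Finset.sum_eq_single x⁻¹]
  · change (Pi.single (1 : G) (f (1 * x⁻¹⁻¹)) : G → L) (x * x⁻¹) = f x
    simp
  · intro g _ hg
    refine Pi.single_eq_of_ne (M := fun _ : G => L.V) (fun h => hg ?_) _
    exact eq_inv_of_mul_eq_one_right h
  · simp

/-- The embedding of a representation in an induced one. -/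
noncomputable def toInduced (L : Rep.{u} k G) : L ⟶ inducedRep L :=
  Rep.ofHom ⟨LinearMap.pi fun x => L.ρ x, fun g => by
    refine LinearMap.ext fun l => funext fun x => ?_
    exact LinearMap.congr_fun (L.ρ.map_mul x g).symm l⟩

/-- The projection of an induced representation onto a given one. -/
noncomputable def ofInduced (L : Rep.{u} k G) : inducedRep L ⟶ L :=
  Rep.ofHom ⟨∑ x : G, L.ρ x⁻¹ ∘ₗ LinearMap.proj x, fun g => by
    refine LinearMap.ext fun (f : G → L) => ?_
    simp only [LinearMap.comp_apply, LinearMap.sum_apply, map_sum]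
    refine Fintype.sum_equiv (Equiv.mulRight g) _ _ fun x => ?_
    change L.ρ x⁻¹ (f (x * g)) = L.ρ g (L.ρ (x * g)⁻¹ (f (x * g)))
    simp [← Module.End.mul_apply, ← map_mul]⟩

omit [Fintype G] in
theorem toInduced_injective (L : Rep.{u} k G) : Function.Injective (toInduced L).hom := by
  intro a b h
  have h1 : L.ρ 1 a = L.ρ 1 b := congrFun h 1
  simpa using h1

theorem ofInduced_surjective (L : Rep.{u} k G) : Function.Surjective (ofInduced L).hom := by
  classical
  intro l
  refine ⟨(Pi.single (1 : G) l : G → L), ?_⟩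
  change (∑ x : G, L.ρ x⁻¹ ∘ₗ LinearMap.proj x) (Pi.single (1 : G) l : G → L) = l
  rw [LinearMap.sum_apply, Finset.sum_eq_single 1]
  · simp
  · intro x _ hx
    simp [Pi.single_eq_of_ne hx]
  · simp

/-- A projective module is a retract of the induced module that covers it, and sums of conjugates
pass to retracts. -/
theorem isInduced_of_projective (P : Rep.{u} k G) [Projective P] : IsInduced P := by
  obtain ⟨e, he⟩ := isInduced_inducedRep P
  have : Epi (ofInduced P) := (Rep.epi_iff_surjective _).2 (ofInduced_surjective P)
  let s : P ⟶ inducedRep P := Projective.factorThru (𝟙 P) (ofInduced P)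
  have hs : s ≫ ofInduced P = 𝟙 P := Projective.factorThru_comp _ _
  refine ⟨(ofInduced P).hom.toLinearMap ∘ₗ e ∘ₗ s.hom.toLinearMap, ?_⟩
  rw [← comp_conjSum (σ := (inducedRep P).ρ) _ (fun g x => Rep.hom_comm_apply (ofInduced P) g x),
    ← conjSum_comp (σ := (inducedRep P).ρ) _ (fun g x => Rep.hom_comm_apply s g x), he]
  exact LinearMap.ext fun x => congrArg (fun f : P ⟶ P => f.hom x) hs

end Induced

/-! ### Functions on the cosets of a normal subgroup -/

section CosetRep

variable {k G : Type u} [Field k] [Group G] (C : Subgroup G) [C.Normal]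

/-- The representation of `G` on the functions `G ⧸ C → L`, for the action of `G` on both `G ⧸ C`
and `L`. -/
noncomputable def cosetRep (L : Rep.{u} k G) : Rep.{u} k G :=
  Rep.of (X := G ⧸ C → L) (ρ :=
    { toFun g := LinearMap.pi fun x => L.ρ g ∘ₗ LinearMap.proj ((g : G ⧸ C)⁻¹ * x)
      map_one' := by ext; simp
      map_mul' _ _ := by ext; simp [mul_assoc] })

/-- Pointwise application of a homomorphism. -/
noncomputable def cosetRepMap {L M : Rep.{u} k G} (φ : L ⟶ M) : cosetRep C L ⟶ cosetRep C M :=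
  Rep.ofHom ⟨φ.hom.toLinearMap.compLeft (G ⧸ C), fun g => by
    refine LinearMap.ext fun (f : G ⧸ C → L) => funext fun x => ?_
    exact Rep.hom_comm_apply φ g _⟩

/-- Right translation by an element of `G ⧸ C`. -/
noncomputable def cosetTranslate (L : Rep.{u} k G) (q : G ⧸ C) : cosetRep C L ⟶ cosetRep C L :=
  Rep.ofHom ⟨LinearMap.funLeft k L (· * q), fun g => by
    refine LinearMap.ext fun (f : G ⧸ C → L) => funext fun x => ?_
    change L.ρ g (f ((g : G ⧸ C)⁻¹ * (x * q))) = L.ρ g (f ((g : G ⧸ C)⁻¹ * x * q))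
    rw [mul_assoc]⟩

/-- The difference of right translation by an element of `G ⧸ C` and the identity. -/
noncomputable def cosetDiff (L : Rep.{u} k G) (q : G ⧸ C) : cosetRep C L ⟶ cosetRep C L :=
  cosetTranslate C L q - 𝟙 _

theorem cosetDiff_naturality {L M : Rep.{u} k G} (φ : L ⟶ M) (q : G ⧸ C) :
    cosetDiff C L q ≫ cosetRepMap C φ = cosetRepMap C φ ≫ cosetDiff C M q := by
  refine Rep.hom_ext (Representation.IntertwiningMap.ext
    (LinearMap.ext fun (f : G ⧸ C → L) => funext fun x => ?_))
  exact map_sub φ.hom.toLinearMap _ _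

theorem isInduced_cosetRep [Fintype G] {L : Rep.{u} k G} (h : IsInduced L) :
    IsInduced (cosetRep C L) := by
  obtain ⟨e, he⟩ := h
  refine ⟨e.compLeft (G ⧸ C), LinearMap.ext fun f => (conjSum_apply _ f).trans (funext fun x => ?_)⟩
  change G ⧸ C → L at f
  refine (Finset.sum_apply x Finset.univ _).trans ?_
  refine Eq.trans (Finset.sum_congr rfl fun g _ => ?_) ((conjSum_apply e (f x)).symm.trans
    (LinearMap.congr_fun he (f x)))
  change L.ρ g (e (L.ρ g⁻¹ (f (((g⁻¹ : G) : G ⧸ C)⁻¹ * ((g : G ⧸ C)⁻¹ * x))))) = _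
  simp

/-- The short complex of functions on `G ⧸ C` with values in a given short complex. -/
noncomputable def cosetComplex (S : ShortComplex (Rep.{u} k G)) : ShortComplex (Rep.{u} k G) :=
  ShortComplex.mk (cosetRepMap C S.f) (cosetRepMap C S.g) (by
    refine Rep.hom_ext (Representation.IntertwiningMap.ext
      (LinearMap.ext fun (f : G ⧸ C → S.X₁) => funext fun x => ?_))
    exact congrArg (fun φ : S.X₁ ⟶ S.X₃ => φ.hom (f x)) S.zero)

theorem cosetComplex_shortExact {S : ShortComplex (Rep.{u} k G)} (hS : S.ShortExact) :
    (cosetComplex C S).ShortExact := by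
  rw [shortExact_iff] at hS ⊢
  obtain ⟨h1, h2, h3⟩ := hS
  refine ⟨?_, ?_, ?_⟩
  · exact h1.comp_left
  · exact h2.comp_left
  · intro (f : G ⧸ C → S.X₂) hf
    choose y hy using fun x => h3 (f x) (congrFun hf x)
    exact ⟨y, funext hy⟩

end CosetRep

/-! ### Dimension shifting for stably trivial actions -/

section CentralTrace

variable {k G : Type u} [Field k] [Group G] [Fintype G] (C : Subgroup G) [Fintype C]

/-- Every element of `G` acts on `L` as the identity, up to a sum of `C`-conjugates. If `C` is
central, this says that `G` acts trivially on `L` in the stable category of `C`. -/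
def ActsStablyTrivially (L : Rep.{u} k G) : Prop :=
  ∀ g : G, ∃ e : L →ₗ[k] L,
    conjSum (L.ρ.comp C.subtype) (L.ρ.comp C.subtype) e = L.ρ g - LinearMap.id

omit [Fintype G] in
theorem actsStablyTrivially_trivial : ActsStablyTrivially C (Rep.trivial k G k) := by
  intro g
  refine ⟨0, conjSum_zero.trans (LinearMap.ext fun x => ?_)⟩
  simp

variable {C}

/-- The map `t` lifts `g - 1` on `S.X₃` to a `C`-equivariant map into `S.X₂`. Then `θ = g - 1 - t ∘
π` is `C`-equivariant, since `C` is central, and has image in `S.X₁`. So `g - 1` on `S.X₁` factors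
`C`-equivariantly through `S.X₂`, whose identity is a sum of `C`-conjugates. -/
theorem ActsStablyTrivially.left (hC : C ≤ Subgroup.center G) {S : ShortComplex (Rep.{u} k G)}
    (hS : S.ShortExact) (h₂ : IsInduced S.X₂) (h₃ : ActsStablyTrivially C S.X₃) :
    ActsStablyTrivially C S.X₁ := by
  intro g
  obtain ⟨h1, h2, h3⟩ := (shortExact_iff S).1 hS
  obtain ⟨e, he⟩ := h₃ g
  obtain ⟨E, hE⟩ := h₂
  obtain ⟨D, hD⟩ := exists_conjSum_subgroup (ρ := S.X₂.ρ) (σ := S.X₂.ρ) C E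
  rw [hE] at hD
  let π := S.g.hom.toLinearMap
  let ι := S.f.hom.toLinearMap
  have hι : ∀ (c : C) x, ι ((S.X₁.ρ.comp C.subtype) c x) = (S.X₂.ρ.comp C.subtype) c (ι x) :=
    fun c x => Rep.hom_comm_apply S.f _ x
  have hπ : ∀ (c : C) x, π ((S.X₂.ρ.comp C.subtype) c x) = (S.X₃.ρ.comp C.subtype) c (π x) :=
    fun c x => Rep.hom_comm_apply S.g _ x
  have hπι : ∀ x, π (ι x) = 0 := fun x => congrArg (fun φ : S.X₁ ⟶ S.X₃ => φ.hom x) S.zero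
  obtain ⟨s, hs⟩ := π.exists_rightInverse_of_surjective (LinearMap.range_eq_top.2 h2)
  obtain ⟨r, hr⟩ := ι.exists_leftInverse_of_injective (LinearMap.ker_eq_bot.2 h1)
  let t := conjSum (S.X₃.ρ.comp C.subtype) (S.X₂.ρ.comp C.subtype) (s ∘ₗ e)
  have ht : π ∘ₗ t = S.X₃.ρ g - LinearMap.id := by
    rw [comp_conjSum _ hπ, ← LinearMap.comp_assoc, hs, LinearMap.id_comp, he]
  let θ : S.X₂ →ₗ[k] S.X₂ := S.X₂.ρ g - LinearMap.id - t ∘ₗ π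
  have hθ : ∀ x, ι (r (θ x)) = θ x := by
    intro x
    obtain ⟨y, hy⟩ := h3 (θ x) (by
      change π (S.X₂.ρ g x - x - t (π x)) = 0
      have := LinearMap.congr_fun ht (π x)
      rw [LinearMap.comp_apply] at this
      rw [map_sub, map_sub, this]
      change S.g.hom (S.X₂.ρ g x) - _ - (S.X₃.ρ g (S.g.hom x) - _) = 0
      rw [Rep.hom_comm_apply]
      exact sub_self _)
    rw [← hy]
    exact congrArg ι (LinearMap.congr_fun hr y)
  have hθC : ∀ (c : C) x,
      θ ((S.X₂.ρ.comp C.subtype) c x) = (S.X₂.ρ.comp C.subtype) c (θ x) := by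
    intro c x
    have hc : S.X₂.ρ g (S.X₂.ρ c x) = S.X₂.ρ c (S.X₂.ρ g x) := by
      rw [← Module.End.mul_apply, ← map_mul, (Subgroup.mem_center_iff.1 (hC c.2) g), map_mul,
        Module.End.mul_apply]
    have ht' := conjSum_equivariant (ρ := S.X₃.ρ.comp C.subtype) (σ := S.X₂.ρ.comp C.subtype)
      (s ∘ₗ e) c (π x)
    simp only [θ, LinearMap.sub_apply, LinearMap.comp_apply, LinearMap.id_apply, map_sub, hπ]
    rw [ht']
    congr 2
  have hrθ : ∀ (c : C) x,
      (r ∘ₗ θ) ((S.X₂.ρ.comp C.subtype) c x) = (S.X₁.ρ.comp C.subtype) c ((r ∘ₗ θ) x) := by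
    intro c x
    apply h1
    change ι (r (θ _)) = ι _
    rw [hθ, hι, hθC]
    exact congrArg _ (hθ x).symm
  refine ⟨(r ∘ₗ θ) ∘ₗ D ∘ₗ ι, ?_⟩
  rw [← comp_conjSum _ hrθ, ← conjSum_comp _ hι, hD]
  refine LinearMap.ext fun x => h1 ?_
  change ι (r (θ (ι x))) = ι (S.X₁.ρ g x - x)
  rw [hθ]
  simp only [θ, LinearMap.sub_apply, LinearMap.comp_apply, LinearMap.id_apply, map_sub, hπι,
    map_zero, sub_zero]
  exact congrArg (· - ι x) (Rep.hom_comm_apply S.f g x).symm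

/-- Dual to the other direction: `t` extends `g - 1` from `S.X₁` to `S.X₂`, so `θ = g - 1 - ι ∘ t`
kills `S.X₁` and descends to `S.X₃`. The linear section `s` computes the descended map, which is
`C`-equivariant although `s` need not be. -/
theorem ActsStablyTrivially.right (hC : C ≤ Subgroup.center G) {S : ShortComplex (Rep.{u} k G)}
    (hS : S.ShortExact) (h₂ : IsInduced S.X₂) (h₁ : ActsStablyTrivially C S.X₁) :
    ActsStablyTrivially C S.X₃ := by
  intro g
  obtain ⟨h1, h2, h3⟩ := (shortExact_iff S).1 hS
  obtain ⟨e, he⟩ := h₁ g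
  obtain ⟨E, hE⟩ := h₂
  obtain ⟨D, hD⟩ := exists_conjSum_subgroup (ρ := S.X₂.ρ) (σ := S.X₂.ρ) C E
  rw [hE] at hD
  let π := S.g.hom.toLinearMap
  let ι := S.f.hom.toLinearMap
  have hι : ∀ (c : C) x, ι ((S.X₁.ρ.comp C.subtype) c x) = (S.X₂.ρ.comp C.subtype) c (ι x) :=
    fun c x => Rep.hom_comm_apply S.f _ x
  have hπ : ∀ (c : C) x, π ((S.X₂.ρ.comp C.subtype) c x) = (S.X₃.ρ.comp C.subtype) c (π x) :=
    fun c x => Rep.hom_comm_apply S.g _ x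
  have hπι : ∀ x, π (ι x) = 0 := fun x => congrArg (fun φ : S.X₁ ⟶ S.X₃ => φ.hom x) S.zero
  obtain ⟨s, hs⟩ := π.exists_rightInverse_of_surjective (LinearMap.range_eq_top.2 h2)
  obtain ⟨r, hr⟩ := ι.exists_leftInverse_of_injective (LinearMap.ker_eq_bot.2 h1)
  let t := conjSum (S.X₂.ρ.comp C.subtype) (S.X₁.ρ.comp C.subtype) (e ∘ₗ r)
  have ht : t ∘ₗ ι = S.X₁.ρ g - LinearMap.id := by
    rw [conjSum_comp _ hι, LinearMap.comp_assoc, hr, LinearMap.comp_id, he]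
  let θ : S.X₂ →ₗ[k] S.X₂ := S.X₂.ρ g - LinearMap.id - ι ∘ₗ t
  have hθι : ∀ x, θ (ι x) = 0 := by
    intro x
    have := LinearMap.congr_fun ht x
    rw [LinearMap.comp_apply] at this
    simp only [θ, LinearMap.sub_apply, LinearMap.comp_apply, LinearMap.id_apply, this, map_sub]
    exact sub_eq_zero.2 (congrArg (· - ι x) (Rep.hom_comm_apply S.f g x).symm)
  have hθ : ∀ x y, π x = π y → θ x = θ y := by
    intro x y hxy
    obtain ⟨z, hz⟩ := h3 (x - y) (by
      change π (x - y) = 0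
      rw [map_sub, hxy, sub_self])
    rw [← sub_eq_zero, ← map_sub, ← hz]
    exact hθι z
  have hs' : ∀ x, π (s x) = x := fun x => LinearMap.congr_fun hs x
  have hθC : ∀ (c : C) x,
      θ ((S.X₂.ρ.comp C.subtype) c x) = (S.X₂.ρ.comp C.subtype) c (θ x) := by
    intro c x
    have hc : S.X₂.ρ g (S.X₂.ρ c x) = S.X₂.ρ c (S.X₂.ρ g x) := by
      rw [← Module.End.mul_apply, ← map_mul, (Subgroup.mem_center_iff.1 (hC c.2) g), map_mul,
        Module.End.mul_apply]
    have ht' := conjSum_equivariant (ρ := S.X₂.ρ.comp C.subtype) (σ := S.X₁.ρ.comp C.subtype)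
      (e ∘ₗ r) c x
    simp only [θ, LinearMap.sub_apply, LinearMap.comp_apply, LinearMap.id_apply, map_sub, ← hι]
    rw [← ht']
    congr 2
  have hθs : ∀ (c : C) x,
      (θ ∘ₗ s) ((S.X₃.ρ.comp C.subtype) c x) = (S.X₂.ρ.comp C.subtype) c ((θ ∘ₗ s) x) := by
    intro c x
    change θ (s _) = (S.X₂.ρ.comp C.subtype) c (θ (s x))
    rw [← hθC]
    refine hθ _ _ ?_
    rw [hs', hπ, hs']
  refine ⟨π ∘ₗ D ∘ₗ (θ ∘ₗ s), ?_⟩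
  rw [← comp_conjSum _ hπ, ← conjSum_comp _ hθs, hD]
  refine LinearMap.ext fun x => ?_
  change π (S.X₂.ρ g (s x) - s x - ι (t (s x))) = S.X₃.ρ g x - x
  rw [map_sub, map_sub, hπι, sub_zero, hs']
  refine congrArg (· - x) ((Rep.hom_comm_apply S.g g (s x)).trans (congrArg _ (hs' x)))

end CentralTrace

/-! ### Tate cohomology and the ghost property -/

section Tate

theorem homologyMap_eq_zero_of_lift {R : Type u} [CommRing R]
    {K L : CochainComplex (ModuleCat.{u} R) ℤ}
    (φ : K ⟶ L) (i j l : ℤ)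
    (h : ∀ x : K.X j, K.d j l x = 0 → ∃ y : L.X i, L.d i j y = φ.f j x) :
    HomologicalComplex.homologyMap φ j = 0 := by
  rw [← cancel_epi (K.homologyπ j), HomologicalComplex.homologyπ_naturality, Limits.comp_zero]
  ext x
  have hx : K.d j l (K.iCycles j x) = 0 := by
    rw [← ModuleCat.comp_apply, K.iCycles_d]
    rfl
  obtain ⟨y, hy⟩ := h _ hx
  have hcyc : HomologicalComplex.cyclesMap φ j x = L.toCycles i j y := by
    apply (ModuleCat.mono_iff_injective (L.iCycles j)).1 inferInstance
    rw [← ModuleCat.comp_apply, ← ModuleCat.comp_apply, HomologicalComplex.cyclesMap_i,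
      L.toCycles_i, hy]
    rfl
  change L.homologyπ j (HomologicalComplex.cyclesMap φ j x) = 0
  rw [hcyc, ← ModuleCat.comp_apply, L.toCycles_comp_homologyπ]
  rfl

variable {k G : Type u} [Field k] [Group G] [Fintype G]

open groupCohomology groupHomology

/-- Degree 0 Tate cohomology is the invariants modulo the norms. -/
theorem tateCohomology_zero_map_eq_zero {M N : Rep.{u} k G} (φ : M ⟶ N)
    (h : ∀ x : M, (∀ g, M.ρ g x = x) → ∃ y : N, N.ρ.norm y = φ.hom x) :
    (tateCohomologyFunctor 0).map φ = 0 := by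
  refine homologyMap_eq_zero_of_lift _ (-1) 0 1 ?_
  intro x hx
  change (Fin 0 → G) → M at x
  change (inhomogeneousCochains M).d 0 1 x = 0 at hx
  obtain ⟨y, hy⟩ := h (x default) fun g => by
    have hx' := congrFun hx fun _ => g
    rw [inhomogeneousCochains.d_def] at hx'
    simp only [inhomogeneousCochains.d_hom_apply, Fin.sum_univ_succ, Finset.univ_eq_empty,
      Finset.sum_empty, add_zero,
      Subsingleton.elim _ (default : Fin 0 → G), Fin.val_zero, zero_add,
      pow_one, neg_smul, one_smul] at hx'
    exact add_neg_eq_zero.1 hx'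
  refine ⟨Finsupp.single default y, ?_⟩
  change N.tateNorm (Finsupp.single default y) = _
  rw [Rep.tateNorm_eq]
  refine funext fun j => ?_
  obtain rfl := Subsingleton.elim default j
  refine Eq.trans ?_ hy
  simp

/-- If `a` has norm zero, then `∑ g, e (g⁻¹ a) = e 0 = 0`, so `a = ∑ g, (g - 1) e (g⁻¹ a)` is a
boundary. -/
theorem isZero_tateCohomology_neg_one {A : Rep.{u} k G} (hA : IsInduced A) :
    Limits.IsZero (tateCohomology A (-1)) := by
  obtain ⟨e, he⟩ := hA
  rw [Limits.IsZero.iff_id_eq_zero, ← (tateCohomologyFunctor (-1)).map_id]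
  refine homologyMap_eq_zero_of_lift _ (-2) (-1) 0 ?_
  intro x hx
  change (Fin 0 → G) →₀ A at x
  change A.tateNorm x = 0 at hx
  rw [Rep.tateNorm_eq] at hx
  obtain ⟨a, rfl⟩ : ∃ a, Finsupp.single default a = x := ⟨x default, by
    ext
    simp⟩
  have ha : ∑ g, A.ρ g a = 0 := by
    refine Eq.trans ?_ (congrFun hx default)
    simp [Representation.norm]
  refine ⟨∑ g : G, Finsupp.single (fun _ : Fin 1 => g⁻¹) (e (A.ρ g⁻¹ a)), ?_⟩
  change (inhomogeneousChains A).d 1 0 (∑ g : G, _) = _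
  rw [inhomogeneousChains.d_def, map_sum]
  have h1 : ∀ g : G, inhomogeneousChains.d A 0
      (Finsupp.single (fun _ : Fin 1 => g⁻¹) (e (A.ρ g⁻¹ a))) =
      Finsupp.single default (A.ρ g (e (A.ρ g⁻¹ a)) - e (A.ρ g⁻¹ a)) := fun g => by
    rw [inhomogeneousChains.d_single]
    simp only [Fin.sum_univ_succ, Finset.univ_eq_empty,
      Finset.sum_empty, add_zero, Subsingleton.elim _ (default : Fin 0 → G),
      Fin.val_zero, zero_add, pow_one, neg_smul, one_smul, inv_inv,
      Finsupp.single_add, Finsupp.single_neg, sub_eq_add_neg]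
  have h2 : ∑ g : G, A.ρ g (e (A.ρ g⁻¹ a)) = a :=
    (conjSum_apply e a).symm.trans (LinearMap.congr_fun he a)
  have h3 : ∑ g : G, e (A.ρ g⁻¹ a) = 0 := by
    exact (map_sum e _ _).symm.trans ((congrArg e
      ((Equiv.sum_comp (Equiv.inv G) fun g => A.ρ g a).trans ha)).trans (map_zero e))
  simp only [h1]
  rw [← Finsupp.single_finsetSum, Finset.sum_sub_distrib, h2, h3, sub_zero,
    CategoryTheory.Functor.map_id]
  rfl

/-- An induced representation is a retract of one that is coinduced from the trivial subgroup. -/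
theorem exists_retract_coind {A : Rep.{u} k G} (hA : IsInduced A) :
    Nonempty (Retract A (Rep.coind (⊥ : Subgroup G).subtype
      (Rep.res (⊥ : Subgroup G).subtype A))) := by
  obtain ⟨e, he⟩ := hA
  let B := Rep.coind (⊥ : Subgroup G).subtype (Rep.res (⊥ : Subgroup G).subtype A)
  let i : A ⟶ B := Rep.ofHom ⟨(LinearMap.pi fun x => e ∘ₗ A.ρ x).codRestrict _ (by
      rintro a ⟨g, hg⟩ x
      obtain rfl := Subgroup.mem_bot.1 hg
      simp), fun g => by
    refine LinearMap.ext fun a => Subtype.ext (funext fun x => ?_)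
    exact congrArg e (LinearMap.congr_fun (A.ρ.map_mul x g).symm a)⟩
  let r : B ⟶ A := Rep.ofHom ⟨(∑ x : G, A.ρ x⁻¹ ∘ₗ LinearMap.proj x) ∘ₗ Submodule.subtype _,
    fun g => by
      refine LinearMap.ext fun f => ?_
      simp only [LinearMap.comp_apply, LinearMap.sum_apply, map_sum]
      refine Fintype.sum_equiv (Equiv.mulRight g) _ _ fun x => ?_
      change A.ρ x⁻¹ (f.1 (x * g)) = A.ρ g (A.ρ (x * g)⁻¹ (f.1 (x * g)))
      simp [← Module.End.mul_apply, ← map_mul]⟩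
  refine ⟨⟨i, r, Rep.hom_ext (Representation.IntertwiningMap.ext (LinearMap.ext fun a => ?_))⟩⟩
  change (∑ x : G, A.ρ x⁻¹ ∘ₗ LinearMap.proj x) (fun x => e (A.ρ x a)) = a
  refine Eq.trans ?_ ((conjSum_apply e a).symm.trans (LinearMap.congr_fun he a))
  rw [LinearMap.sum_apply, ← Equiv.sum_comp (Equiv.inv G)]
  exact Finset.sum_congr rfl fun x _ => by simp

/-- Nonzero degrees suffice: shifting away from degree 0 only meets the middle term in the degree
being reached. -/
theorem isZero_tateCohomology {A : Rep.{u} k G} (hA : IsInduced A) {n : ℤ} (hn : n ≠ 0) :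
    Limits.IsZero (tateCohomology A n) := by
  classical
  obtain ⟨R⟩ := exists_retract_coind hA
  obtain (h | rfl | h) : 0 < n ∨ n = -1 ∨ n < -1 := by omega
  · obtain ⟨m, rfl⟩ : ∃ m : ℕ, n = ((m + 1 : ℕ) : ℤ) := ⟨(n - 1).toNat, by omega⟩
    refine Limits.IsZero.of_iso ?_ ((TateCohomology.isoGroupCohomology (m + 1)).app A)
    refine Limits.IsZero.of_mono ((groupCohomology.functor k G (m + 1)).map R.i) ?_
    exact (isZero_groupCohomology_succ_of_subsingleton _ m).of_iso (coindIso _ (m + 1))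
  · exact isZero_tateCohomology_neg_one hA
  · obtain ⟨m, rfl⟩ : ∃ m : ℕ, n = -(((m + 1 : ℕ) : ℤ) + 1) := ⟨(-n - 2).toNat, by omega⟩
    refine Limits.IsZero.of_iso ?_ ((TateCohomology.isoGroupHomology _ (m + 1) rfl).app A)
    refine Limits.IsZero.of_mono
      ((groupHomology.functor k G (m + 1)).map (R.i ≫ (Rep.indCoindIso _).inv)) ?_
    exact (isZero_groupHomology_succ_of_subsingleton _ m).of_iso (indIso _ _ (m + 1))

variable (C : Subgroup G) [C.Normal] [Fintype C]

/-- An invariant `f` is determined by the `C`-fixed vector `f 1`, and translation by the class of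
`g₀` changes this vector by `g₀ (f 1) - f 1`. By hypothesis the difference is a `C`-trace, which
makes the change in `f` a `G`-norm. -/
theorem tateCohomology_zero_cosetDiff {L : Rep.{u} k G} (hL : ActsStablyTrivially C L) (q : G ⧸ C) :
    (tateCohomologyFunctor 0).map (cosetDiff C L q) = 0 := by
  classical
  refine tateCohomology_zero_map_eq_zero _ fun (f : G ⧸ C → L) hf => ?_
  have hf' : ∀ g h : G, f (g * h : G) = L.ρ g (f h) := fun g h => by
    have h1 : L.ρ g (f ((g : G ⧸ C)⁻¹ * (g * h : G))) = f (g * h : G) := congrFun (hf g) (g * h : G)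
    rw [← h1]
    simp
  obtain ⟨g₀, rfl⟩ := QuotientGroup.mk_surjective q
  obtain ⟨e, he⟩ := hL g₀
  -- At the coset of `y`, the norm of this function only sees the elements `y * c`, so it is `y`
  -- applied to the `C`-trace of `e (f 1)`.
  let m : G ⧸ C → L := Pi.single (1 : G ⧸ C) (e (f 1))
  refine ⟨m, funext fun x => ?_⟩
  obtain ⟨y, rfl⟩ := QuotientGroup.mk_surjective x
  have h1 : ∀ g : G, f g = L.ρ g (f 1) := fun g => by simpa using hf' g 1
  have hl : ∀ c : C, L.ρ (c⁻¹ : C) (f 1) = f 1 := fun c => by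
    rw [← h1, (QuotientGroup.eq_one_iff _).2 (c⁻¹).2]
  have h2 : ∑ c : C, L.ρ c (e (f 1)) = L.ρ g₀ (f 1) - f 1 := by
    have := (conjSum_apply e (f 1)).symm.trans (LinearMap.congr_fun he (f 1))
    refine Eq.trans (Finset.sum_congr rfl fun c _ => ?_) this
    exact congrArg (fun l => L.ρ c (e l)) (hl c).symm
  change (show G ⧸ C → L from (cosetRep C L).ρ.norm m) y = f (y * g₀ : G) - f y
  rw [hf', h1 y, h1 g₀, ← map_sub, ← h2]
  have h3 : (cosetRep C L).ρ.norm m = ∑ g, (cosetRep C L).ρ g m :=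
    LinearMap.sum_apply _ _ _
  rw [h3]
  refine (Finset.sum_apply (y : G ⧸ C) Finset.univ _).trans ?_
  change ∑ g : G, L.ρ g (m ((g : G ⧸ C)⁻¹ * y)) = _
  rw [← Equiv.sum_comp (Equiv.mulLeft y), map_sum]
  refine (Fintype.sum_of_injective (Subtype.val : C → G) Subtype.val_injective _ _ ?_ ?_).symm
  · intro g hg
    have : ((g : G ⧸ C))⁻¹ ≠ 1 := fun h => hg (by
      simpa using (QuotientGroup.eq_one_iff g).1 (inv_eq_one.1 h))
    simp [m, Pi.single_eq_of_ne this]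
  · intro c
    simp [m]

theorem exists_shortExact_left (L : Rep.{u} k G) : ∃ S : ShortComplex (Rep.{u} k G),
    S.ShortExact ∧ IsInduced S.X₂ ∧ S.X₁ = L := by
  have : Mono (toInduced L) := (Rep.mono_iff_injective _).2 (toInduced_injective L)
  exact ⟨ShortComplex.mk _ _ (Limits.cokernel.condition (toInduced L)),
    { exact := ShortComplex.exact_cokernel _ }, isInduced_inducedRep L, rfl⟩

theorem exists_shortExact_right (L : Rep.{u} k G) : ∃ S : ShortComplex (Rep.{u} k G),
    S.ShortExact ∧ IsInduced S.X₂ ∧ S.X₃ = L := by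
  have : Epi (ofInduced L) := (Rep.epi_iff_surjective _).2 (ofInduced_surjective L)
  exact ⟨ShortComplex.mk _ _ (Limits.kernel.condition (ofInduced L)),
    { exact := ShortComplex.exact_kernel _ }, isInduced_inducedRep L, rfl⟩

/-- Translation by `q` and the identity, as a map of short complexes. -/
noncomputable def cosetDiffComplex (S : ShortComplex (Rep.{u} k G)) (q : G ⧸ C) :
    cosetComplex C S ⟶ cosetComplex C S where
  τ₁ := cosetDiff C S.X₁ q
  τ₂ := cosetDiff C S.X₂ q
  τ₃ := cosetDiff C S.X₃ q
  comm₁₂ := cosetDiff_naturality C S.f q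
  comm₂₃ := cosetDiff_naturality C S.g q

variable {C}

theorem tateCohomology_cosetDiff_succ (hC : C ≤ Subgroup.center G) {n : ℤ} (hn : n + 1 ≠ 0)
    (q : G ⧸ C) (h : ∀ L : Rep.{u} k G, ActsStablyTrivially C L →
      (tateCohomologyFunctor n).map (cosetDiff C L q) = 0)
    (L : Rep.{u} k G) (hL : ActsStablyTrivially C L) :
    (tateCohomologyFunctor (n + 1)).map (cosetDiff C L q) = 0 := by
  obtain ⟨S, hS, h₂, rfl⟩ := exists_shortExact_left L
  have hW := cosetComplex_shortExact C hS
  have hepi : Epi (TateCohomology.δ hW n) :=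
    (TateCohomology.exact₁ hW n).epi_f
      ((isZero_tateCohomology (isInduced_cosetRep C h₂) hn).eq_of_tgt _ _)
  have hδ := TateCohomology.δ_naturality hW hW (cosetDiffComplex C S q) n
  have h0 : (tateCohomologyFunctor n).map (cosetDiffComplex C S q).τ₃ = 0 := h _ (hL.right hC hS h₂)
  rw [h0, Limits.zero_comp] at hδ
  exact (cancel_epi (TateCohomology.δ hW n)).1 (hδ.trans Limits.comp_zero.symm)

theorem tateCohomology_cosetDiff_pred (hC : C ≤ Subgroup.center G) {n : ℤ} (hn : n ≠ 0)
    (q : G ⧸ C) (h : ∀ L : Rep.{u} k G, ActsStablyTrivially C L →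
      (tateCohomologyFunctor (n + 1)).map (cosetDiff C L q) = 0)
    (L : Rep.{u} k G) (hL : ActsStablyTrivially C L) :
    (tateCohomologyFunctor n).map (cosetDiff C L q) = 0 := by
  obtain ⟨S, hS, h₂, rfl⟩ := exists_shortExact_right L
  have hW := cosetComplex_shortExact C hS
  have hmono : Mono (TateCohomology.δ hW n) :=
    (TateCohomology.exact₃ hW n).mono_g
      ((isZero_tateCohomology (isInduced_cosetRep C h₂) hn).eq_of_src _ _)
  have hδ := TateCohomology.δ_naturality hW hW (cosetDiffComplex C S q) n
  have h0 : (tateCohomologyFunctor (n + 1)).map (cosetDiffComplex C S q).τ₁ = 0 :=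
    h _ (hL.left hC hS h₂)
  rw [h0, Limits.comp_zero] at hδ
  exact (cancel_mono (TateCohomology.δ hW n)).1 (hδ.symm.trans Limits.zero_comp.symm)

/-- Translation by `q` acts as the identity on the Tate cohomology of the functions on `G ⧸ C` with
values in `L`, if `C` is central and `G` acts trivially on `L` up to `C`-projective maps. -/
theorem tateCohomology_cosetDiff (hC : C ≤ Subgroup.center G) (n : ℤ) (q : G ⧸ C) :
    ∀ L : Rep.{u} k G, ActsStablyTrivially C L →
      (tateCohomologyFunctor n).map (cosetDiff C L q) = 0 := by
  induction n with
  | zero => exact fun L hL => tateCohomology_zero_cosetDiff C hL q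
  | succ n ih => exact tateCohomology_cosetDiff_succ hC (by omega) q ih
  | pred n ih => exact tateCohomology_cosetDiff_pred hC (by omega) q (by rwa [sub_add_cancel])

end Tate

/-! ### The norm element as a product -/

section NormProduct

theorem sub_one_pow_eq_geom_sum {k A : Type*} [Field k] [Ring A] [Algebra k A] {p : ℕ}
    (hp : p.Prime) [CharP k p] (y : A) :
    (y - 1) ^ (p - 1) = ∑ i ∈ Finset.range p, y ^ i := by
  have : Fact p.Prime := ⟨hp⟩
  have h : ((Polynomial.X : Polynomial k) - 1) ^ (p - 1) =
      ∑ i ∈ Finset.range p, Polynomial.X ^ i := by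
    have hX : (Polynomial.X : Polynomial k) - 1 ≠ 0 := by
      simpa using Polynomial.X_sub_C_ne_zero (1 : k)
    apply mul_right_cancel₀ hX
    rw [geom_sum_mul, ← pow_succ, Nat.sub_add_cancel hp.one_le, sub_pow_char, one_pow]
  simpa using congrArg (Polynomial.aeval y) h

/-- In an algebra over a field of characteristic `p`, the norm element of a group of order `p ^ s`
is a product of `s * (p - 1)` factors `q - 1`. -/
theorem exists_list_prod_sub_one_eq_sum {k A : Type*} [Field k] [Ring A] [Algebra k A] {p : ℕ}
    (hp : p.Prime) [CharP k p] (s : ℕ) :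
    ∀ (Q : Type u) [Group Q] [Fintype Q] (ρ : Q →* A), Nat.card Q = p ^ s →
      ∃ l : List Q, l.length = s * (p - 1) ∧ (l.map fun q => ρ q - 1).prod = ∑ q, ρ q := by
  classical
  have : Fact p.Prime := ⟨hp⟩
  induction s with
  | zero =>
    intro Q _ _ ρ hQ
    have : Subsingleton Q := (Nat.card_eq_one_iff_unique.1 (by simpa using hQ)).1
    refine ⟨[], by simp, ?_⟩
    rw [Fintype.sum_subsingleton _ (1 : Q)]
    simp
  | succ s ih =>
    intro Q _ _ ρ hQ
    obtain ⟨N, hN⟩ := Sylow.exists_subgroup_card_pow_prime (G := Q) p (n := s)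
      (hQ ▸ pow_dvd_pow p s.le_succ)
    have hidx : N.index = p := by
      have := N.card_mul_index
      rw [hN, hQ, pow_succ] at this
      exact Nat.eq_of_mul_eq_mul_left (pow_pos hp.pos s) this
    have hnormal : N.Normal := Subgroup.normal_of_index_eq_minFac_card (by
      rw [hidx, hQ, Nat.pow_minFac s.succ_ne_zero, hp.minFac_eq])
    obtain ⟨l, hl, hprod⟩ := ih N (ρ.comp N.subtype) hN
    have hQN : Nat.card (Q ⧸ N) = p := hidx
    have : Nontrivial (Q ⧸ N) := Finite.one_lt_card_iff_nontrivial.1 (hQN ▸ hp.one_lt)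
    obtain ⟨y, hy⟩ := exists_ne (1 : Q ⧸ N)
    obtain ⟨x, rfl⟩ := QuotientGroup.mk_surjective y
    have hord : orderOf (x : Q ⧸ N) = p :=
      (hp.eq_one_or_self_of_dvd _ (hQN ▸ orderOf_dvd_natCard _)).resolve_left
        fun h => hy (orderOf_eq_one_iff.1 h)
    -- `Q` is the disjoint union of the cosets `x ^ i N` for `i < p`, so its norm is `∑ x ^ i = (x -
    -- 1) ^ (p - 1)` times the norm of `N`.
    refine ⟨List.replicate (p - 1) x ++ l.map N.subtype, by simp [hl]; ring, ?_⟩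
    have hl' : ((l.map N.subtype).map fun q => ρ q - 1).prod = ∑ n : N, ρ n := by
      rw [List.map_map]
      exact hprod
    rw [List.map_append, List.prod_append, hl', List.map_replicate, List.prod_replicate,
      sub_one_pow_eq_geom_sum (k := k) hp, Finset.sum_range, Finset.sum_mul_sum,
      ← Fintype.sum_prod_type']
    have hinj : Function.Injective fun z : Fin p × N => x ^ (z.1 : ℕ) * (z.2 : Q) := by
      rintro ⟨i, n⟩ ⟨j, m⟩ h
      have hij : (x : Q ⧸ N) ^ (i : ℕ) = (x : Q ⧸ N) ^ (j : ℕ) := by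
        have := congrArg (QuotientGroup.mk : Q → Q ⧸ N) h
        simpa [(QuotientGroup.eq_one_iff _).2 n.2, (QuotientGroup.eq_one_iff _).2 m.2] using this
      have hij' : i = j := Fin.ext (pow_injOn_Iio_orderOf (by simp [hord]) (by simp [hord]) hij)
      subst hij'
      simpa using h
    refine Fintype.sum_bijective _ ((Fintype.bijective_iff_injective_and_card _).2
      ⟨hinj, ?_⟩) _ _ fun z => by simp
    rw [Fintype.card_prod, Fintype.card_fin, ← Nat.card_eq_fintype_card, hN,
      ← Nat.card_eq_fintype_card, hQ, pow_succ, mul_comm]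

end NormProduct

/-! ### Finite-dimensional modules over a `p`-group -/

section FixedVector

variable {k G : Type u} [Field k] [Group G] [Fintype G]

-- As `k` may be infinite, fixed points are counted in the span over `ZMod p` of one orbit: this is
-- a finite set of order divisible by `p`, so `0` is not its only fixed point.
omit [Fintype G] in
theorem exists_fixed_vector_of_zmodModule [Finite G] {p : ℕ} [Fact p.Prime] (hG : IsPGroup p G)
    {V : Type*} [AddCommGroup V] [Module k V] [Module (ZMod p) V] [Nontrivial V]
    (ρ : Representation k G V) : ∃ v : V, v ≠ 0 ∧ ∀ g, ρ g v = v := by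
  obtain ⟨w, hw⟩ := exists_ne (0 : V)
  let W : Submodule (ZMod p) V := Submodule.span (ZMod p) (Set.range fun g => ρ g w)
  have hfin : Module.Finite (ZMod p) W :=
    Module.Finite.span_of_finite (ZMod p) (Set.finite_range fun g => ρ g w)
  have : Finite W := Module.finite_of_finite (ZMod p)
  have hW : ∀ (g : G) (x : V), x ∈ W → ρ g x ∈ W := by
    intro g x hx
    let f : V →ₗ[ZMod p] V := (ρ g).toAddMonoidHom.toZModLinearMap p
    have : W ≤ W.comap f := Submodule.span_le.2 (by
      rintro _ ⟨h, rfl⟩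
      refine Submodule.subset_span ⟨g * h, ?_⟩
      simp [f])
    exact this hx
  let _ : MulAction G W :=
    { smul g x := ⟨ρ g x, hW g x x.2⟩
      one_smul x := Subtype.ext (by change ρ 1 (x : V) = x; simp)
      mul_smul g h x := Subtype.ext (by change ρ (g * h) (x : V) = ρ g (ρ h x); simp) }
  have hcard : p ∣ Nat.card W := by
    have : Nontrivial W := ⟨⟨⟨w, Submodule.subset_span ⟨1, by simp⟩⟩, 0, fun h =>
      hw (congrArg Subtype.val h)⟩⟩
    rw [Module.natCard_eq_pow_finrank (K := ZMod p), Nat.card_zmod]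
    exact dvd_pow_self p (Module.finrank_pos).ne'
  have h0 : (0 : W) ∈ MulAction.fixedPoints G W := fun g =>
    Subtype.ext (map_zero (ρ g))
  obtain ⟨v, hv, hne⟩ := hG.exists_fixed_point_of_prime_dvd_card_of_fixed_point W hcard h0
  exact ⟨v, fun h => hne (Subtype.ext h.symm), fun g => congrArg Subtype.val (hv g)⟩

theorem exists_fixed_vector {p : ℕ} (hp : p.Prime) [CharP k p] (hG : IsPGroup p G)
    (M : Rep.{u} k G) [Nontrivial M] : ∃ v : M, v ≠ 0 ∧ ∀ g, M.ρ g v = v := by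
  have : Fact p.Prime := ⟨hp⟩
  let _ : Module (ZMod p) M := AddCommGroup.zmodModule (n := p) fun x => by
    rw [← Nat.cast_smul_eq_nsmul k, CharP.cast_eq_zero, zero_smul]
  exact exists_fixed_vector_of_zmodModule hG M.ρ

/-- Over a `p`-group, every finite-dimensional representation in characteristic `p` is in the thick
subcategory generated by the trivial one. -/
theorem thickTriv_of_finite {p : ℕ} (hp : p.Prime) [CharP k p] (hG : IsPGroup p G) (n : ℕ) :
    ∀ M : Rep.{u} k G, Module.Finite k M → Module.finrank k M = n →
      ThickTriv k G ((toStMod k G).obj M) := by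
  induction n with
  | zero =>
    intro M _ hM
    have : Subsingleton M := Module.finrank_zero_iff.1 hM
    have hid : 𝟙 M = 0 := 
      ((Rep.isZero_iff (k := k) G M).2 this).eq_of_src _ _
    refine ThickTriv.retract ⟨(toStMod k G).map 0, (toStMod k G).map 0, ?_⟩ ThickTriv.triv
    rw [← Functor.map_comp, ← CategoryTheory.Functor.map_id, hid, Limits.comp_zero]
  | succ n ih =>
    intro M _ hM
    have : Nontrivial M := Module.nontrivial_of_finrank_pos (R := k) (by omega)
    obtain ⟨v, hv, hfix⟩ := exists_fixed_vector hp hG M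
    let f : Rep.trivial k G k ⟶ M := Rep.ofHom ⟨LinearMap.toSpanSingleton k M v, fun g => by
      ext
      simp [hfix]⟩
    let W : Submodule k M := Submodule.span k {v}
    have hW : ∀ g, W ≤ W.comap (M.ρ g) := fun g => Submodule.span_le.2 (by
      refine Set.singleton_subset_iff.2 ?_
      change M.ρ g v ∈ W
      rw [hfix]
      exact Submodule.mem_span_singleton_self v)
    let S : ShortComplex (Rep.{u} k G) := ShortComplex.mk f (Rep.mkQ M W hW) (by
      refine Rep.hom_ext (Representation.IntertwiningMap.ext (LinearMap.ext fun x => ?_))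
      exact (Submodule.Quotient.mk_eq_zero W).2
        (Submodule.smul_mem _ x (Submodule.mem_span_singleton_self v)))
    have hS : S.ShortExact := by
      refine (shortExact_iff S).2 ⟨?_, Submodule.mkQ_surjective W, fun x hx => ?_⟩
      · exact smul_left_injective k hv
      · exact Submodule.mem_span_singleton.1 ((Submodule.Quotient.mk_eq_zero W).1 hx)
    refine ThickTriv.ext₂ S hS ThickTriv.triv (ih _ (inferInstanceAs (Module.Finite k (M ⧸ W))) ?_)
    have h1 := Submodule.finrank_quotient_add_finrank W
    rw [finrank_span_singleton hv, hM] at h1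
    exact Nat.succ_injective h1

end FixedVector

/-! ### A nonzero composite of ghosts -/

section LowerBound

variable {k G : Type u} [Field k] [Group G] [Fintype G]

/-- A stably trivial map is a sum of conjugates, so it vanishes on modules on which a subgroup of
order divisible by the characteristic acts trivially. -/
theorem eq_zero_of_stablyTrivial {p : ℕ} [CharP k p] (C : Subgroup G)
    (hC : p ∣ Nat.card C) {M N : Rep.{u} k G} (hM : ∀ c ∈ C, M.ρ c = 1) (hN : ∀ c ∈ C, N.ρ c = 1)
    {f : M ⟶ N} (hf : StablyTrivial f) : f = 0 := by
  have : Fintype C := Fintype.ofFinite _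
  obtain ⟨P, hP, a, b, rfl⟩ := hf
  obtain ⟨e, he⟩ := isInduced_of_projective P
  let ψ := b.hom.toLinearMap ∘ₗ e ∘ₗ a.hom.toLinearMap
  have h1 : conjSum M.ρ N.ρ ψ = b.hom.toLinearMap ∘ₗ a.hom.toLinearMap := by
    rw [← comp_conjSum (σ := P.ρ) _ (fun g x => Rep.hom_comm_apply b g x),
      ← conjSum_comp (σ := P.ρ) _ (fun g x => Rep.hom_comm_apply a g x), he]
    rfl
  obtain ⟨d, hd⟩ := exists_conjSum_subgroup (ρ := M.ρ) (σ := N.ρ) C ψ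
  have h2 : conjSum (M.ρ.comp C.subtype) (N.ρ.comp C.subtype) d = 0 := by
    ext v
    have : ∀ c : C, (N.ρ.comp C.subtype) c (d ((M.ρ.comp C.subtype) c⁻¹ v)) = d v := fun c => by
      simp [hN c c.2, hM _ (inv_mem c.2)]
    rw [conjSum_apply]
    simp only [this, Finset.sum_const, Finset.card_univ]
    rw [← Nat.cast_smul_eq_nsmul k, ← Nat.card_eq_fintype_card,
      (CharP.cast_eq_zero_iff k p _).2 hC, zero_smul, LinearMap.zero_apply]
  refine Rep.hom_ext (Representation.IntertwiningMap.ext ?_)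
  exact h1.symm.trans (hd.symm.trans h2)

theorem stMod_map_ne_zero {p : ℕ} [CharP k p] (C : Subgroup G)
    (hC : p ∣ Nat.card C) {M N : Rep.{u} k G} (hM : ∀ c ∈ C, M.ρ c = 1) (hN : ∀ c ∈ C, N.ρ c = 1)
    {f : M ⟶ N} (hf : f ≠ 0) : (toStMod k G).map f ≠ 0 := by
  intro h
  have h1 : stableRel k G f 0 := (Quotient.functor_map_eq_iff _ _ _).1 h
  exact hf (eq_zero_of_stablyTrivial C hC hM hN (by simpa [stableRel] using h1))

/-- The action of a group on the functions on it by right translation. -/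
noncomputable def rightTranslation (k Q : Type*) [Field k] [Group Q] :
    Q →* Module.End k (Q → k) where
  toFun q := LinearMap.funLeft k k (· * q)
  map_one' := by ext; simp [LinearMap.funLeft]
  map_mul' _ _ := by ext; simp [LinearMap.funLeft, mul_assoc]

theorem isGhost_cosetDiff (C : Subgroup G) [C.Normal] (hC : C ≤ Subgroup.center G) (q : G ⧸ C) :
    IsGhost ((toStMod k G).map (cosetDiff C (Rep.trivial k G k) q)) := by
  have : Fintype C := Fintype.ofFinite _
  exact ⟨_, rfl, fun n => tateCohomology_cosetDiff hC n q _ (actsStablyTrivially_trivial C)⟩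

theorem exists_isGhostComposite (C : Subgroup G) [C.Normal] (hC : C ≤ Subgroup.center G)
    (hT : ThickTriv k G ((toStMod k G).obj (cosetRep C (Rep.trivial k G k)))) (l : List (G ⧸ C)) :
    ∃ f : cosetRep C (Rep.trivial k G k) ⟶ cosetRep C (Rep.trivial k G k),
      IsGhostComposite l.length ((toStMod k G).map f) ∧
      ∀ v : G ⧸ C → k, f.hom v = (l.map fun q => rightTranslation k (G ⧸ C) q - 1).prod v := by
  induction l with
  | nil => exact ⟨𝟙 _, IsGhostComposite.zero _ hT hT, fun v => rfl⟩
  | cons q l ih =>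
    obtain ⟨f, hf, hv⟩ := ih
    -- The head of the list is applied last, matching the order of multiplication in `Module.End`.
    refine ⟨f ≫ cosetDiff C _ q, ?_, fun v => ?_⟩
    · rw [Functor.map_comp]
      exact IsGhostComposite.succ _ _ hf hT (isGhost_cosetDiff C hC q)
    · exact congrArg (cosetDiff C _ q).hom (hv v)

/-- All `n ≤ m` must be excluded, not just `m`: initial segments of a nonzero composite of `m`
ghosts are nonzero too. -/
theorem natCast_le_ghostLength {M : StMod k G} {m : ℕ} {N : StMod k G} (f : M ⟶ N)
    (hf : IsGhostComposite m f) (hne : f ≠ 0) : ((m + 1 : ℕ) : ℕ∞) ≤ ghostLength M := by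
  have key : ∀ (m : ℕ) (N : StMod k G) (f : M ⟶ N), IsGhostComposite m f → f ≠ 0 →
      ∀ n ≤ m, ∃ (L : StMod k G) (g : M ⟶ L), IsGhostComposite n g ∧ g ≠ 0 := by
    intro m
    induction m with
    | zero =>
      intro N f hf hne n hn
      obtain rfl := Nat.le_zero.1 hn
      exact ⟨N, f, hf, hne⟩
    | succ m ih =>
      intro N f hf hne n hn
      obtain rfl | hn := Nat.eq_or_lt_of_le hn
      · exact ⟨N, f, hf, hne⟩
      · cases hf with
        | succ f g hf' _ _ =>
          refine ih _ f hf' (fun h => hne ?_) n (Nat.lt_succ_iff.1 hn)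
          rw [h, Limits.zero_comp]
  refine le_iInf₂ fun n hn => ?_
  by_contra hlt
  have hnm : n ≤ m := by
    have : n < m + 1 := by exact_mod_cast not_le.1 hlt
    omega
  obtain ⟨L, g, hg, hg0⟩ := key m N f hf hne n hnm
  exact hg0 (hn L g hg)

theorem exists_central_subgroup {p r : ℕ} (hp : p.Prime) (hr : 1 ≤ r) (hG : Nat.card G = p ^ r) :
    ∃ C : Subgroup G, C ≤ Subgroup.center G ∧ Nat.card C = p := by
  have : Fact p.Prime := ⟨hp⟩
  have : Nontrivial G := Finite.one_lt_card_iff_nontrivial.1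
    (hG ▸ Nat.one_lt_pow (by omega) hp.one_lt)
  have hpG : IsPGroup p G := IsPGroup.of_card hG
  have := hpG.center_nontrivial
  obtain ⟨n, hn, hcard⟩ :=
    ((hpG.to_subgroup (Subgroup.center G)).nontrivial_iff_card).1 inferInstance
  obtain ⟨z, hz⟩ := exists_prime_orderOf_dvd_card' (G := Subgroup.center G) p
    (hcard ▸ dvd_pow_self p hn.ne')
  refine ⟨Subgroup.zpowers (z : G), by simp, ?_⟩
  rw [Nat.card_zpowers, Subgroup.orderOf_coe, hz]

end LowerBound

end GhostNumber

theorem mainTheorem12 {k G : Type u} [Field k] [Group G] [Fintype G]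
    (p r : ℕ) (hp : p.Prime) [CharP k p] (hr : 1 ≤ r) (hG : Nat.card G = p ^ r) :
    (((r - 1) * (p - 1) + 1 : ℕ) : ℕ∞) ≤ GhostNumber.ghostNumber k G := by
  classical
  open GhostNumber in
  obtain ⟨C, hC, hCp⟩ := exists_central_subgroup hp hr hG
  have : C.Normal := ⟨fun c hc g => by
    rwa [Subgroup.mem_center_iff.1 (hC hc) g, mul_inv_cancel_right]⟩
  have : Fintype (G ⧸ C) := Fintype.ofFinite _
  let M := cosetRep C (Rep.trivial k G k)
  have hT : ThickTriv k G ((toStMod k G).obj M) :=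
    thickTriv_of_finite hp (IsPGroup.of_card hG) _ M (inferInstanceAs (Module.Finite k (G ⧸ C → k)))
      rfl
  have hQ : Nat.card (G ⧸ C) = p ^ (r - 1) := by
    have h := C.card_eq_card_quotient_mul_card_subgroup
    rw [hG, hCp, ← Nat.sub_add_cancel hr, pow_succ] at h
    exact (Nat.eq_of_mul_eq_mul_right hp.pos h).symm
  obtain ⟨l, hl, hprod⟩ := exists_list_prod_sub_one_eq_sum (k := k) hp (r - 1) (G ⧸ C)
    (rightTranslation k (G ⧸ C)) hQ
  obtain ⟨f, hf, hfv⟩ := exists_isGhostComposite C hC hT l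
  -- The norm sends the indicator function of `1` to the constant function `1`.
  have hne : f ≠ 0 := by
    rintro rfl
    have h : (0 : G ⧸ C → k) = _ := hfv (Pi.single 1 1)
    rw [hprod] at h
    have h1 := congrFun h 1
    simp [rightTranslation, LinearMap.funLeft, LinearMap.sum_apply] at h1
  have hM : ∀ c ∈ C, M.ρ c = 1 := fun c hc => by
    refine LinearMap.ext fun (v : G ⧸ C → k) => funext fun x => ?_
    change v ((c : G ⧸ C)⁻¹ * x) = v x
    rw [(QuotientGroup.eq_one_iff c).2 hc, inv_one, one_mul]
  rw [hl] at hf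
  exact (natCast_le_ghostLength _ hf (stMod_map_ne_zero C hCp.symm.dvd hM hM hne)).trans
    (le_iSup₂_of_le _ hT le_rfl)
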